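/- Let $p$ be a prime and $d$ a positive integer. Let $\mathbb{C}_p$ be the completion of an algebraic closure of $\mathbb{Q}_p$, with valuation $v_p$ normalized by $v_p(p)=1$ (and $v_p(0)=+\infty$). Let $\mathcal{P}_{d,p}$ be the set of monic polynomials $f\in\mathbb{C}_p[z]$ of degree $d$ with $f(0)=0$, and let $\mathcal{M}_{d,p}$ be the set of those $f\in\mathcal{P}_{d,p}$ that are post-critically bounded, i.e. every critical point $c\in\mathbb{C}_p$ of $f$ (every $c$ with $f'(c)=0$) has bounded orbit under iteration of $f$. Define $$r(d,p)=\sup_{f\in\mathcal{M}_{d,p}}\ \max_{\substack{c\in\mathbb{C}_p\\ f'(c)=0}}\{-v_p(c)\}\in[-\infty,+\infty].$$ If $\tfrac12 d<p<d$, then $$r(d,p)=\frac{p}{d-1}.$$ If $p=\tfrac12 d$, then $r(d,p)=0$. -/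

import Mathlib

namespace PadicMandelbrot

/-- The `p`-adic valuation on `ℂ_[p]`, normalized by `v p = 1`, so that `‖x‖ = p ^ (-v x)` for
`x ≠ 0`, and with `v 0 = +∞`. -/
noncomputable def val (p : ℕ) [Fact p.Prime] (x : ℂ_[p]) : EReal :=
  open Classical in if x = 0 then ⊤ else ((-Real.logb (p : ℝ) ‖x‖ : ℝ) : EReal)

/-- The monic polynomials of degree `d` over `ℂ_[p]` with `f(0) = 0`. -/
def paramSpace (d p : ℕ) [Fact p.Prime] : Set (Polynomial ℂ_[p]) :=
  {f | f.Monic ∧ f.natDegree = d ∧ f.eval 0 = 0}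

/-- The set of critical points of `f`. -/
def critPoints {p : ℕ} [Fact p.Prime] (f : Polynomial ℂ_[p]) : Set ℂ_[p] :=
  {c | (Polynomial.derivative f).eval c = 0}

/-- `f` is post-critically bounded: the forward orbit of every critical point is bounded. -/
def IsPCB {p : ℕ} [Fact p.Prime] (f : Polynomial ℂ_[p]) : Prop :=
  ∀ c ∈ critPoints f,
    Bornology.IsBounded (Set.range fun n : ℕ => (fun z : ℂ_[p] => f.eval z)^[n] c)

/-- The `p`-adic Mandelbrot set of degree `d`: the post-critically bounded members of the
parameter space. -/
def mandelbrotSet (d p : ℕ) [Fact p.Prime] : Set (Polynomial ℂ_[p]) :=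
  {f | f ∈ paramSpace d p ∧ IsPCB f}

/-- The critical radius `r(d,p)`, as an extended real: the supremum over `f` in the Mandelbrot set
of the maximum of `-v(c)` over the critical points `c` of `f`. For `d ≥ 2` the critical points of
such an `f` form a nonempty finite set, so the inner supremum is a maximum. -/
noncomputable def critRadius (d p : ℕ) [Fact p.Prime] : EReal :=
  ⨆ f ∈ mandelbrotSet d p, ⨆ c ∈ critPoints f, -val p c

end PadicMandelbrot

open Polynomial

namespace PadicMandelbrot

/-! ### Products of linear factors. -/

section NormedField

variable {K : Type*} [NormedField K]

/-! Upper bound: let `R` be the largest norm of a root of `f`; since 0 is a root, `R` is also the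
diameter of the root set. Points of norm above `max R 1` escape, so for `R ≤ 1` all critical points
lie in the closed unit disc. For `R > 1`, critical points and critical values have norm at most `R`,
so each critical point is at distance `< R` from a root. The `d` roots meet at least two open balls
of radius `R` and there are only `d - 1` critical points, so some such ball has at least as many
critical points as roots (`exists_card_filter_le`).

Let that ball, around a root `a`, contain `e` roots. Comparing coefficients of `f'` at `a`
(`norm_card_filter_mul_le`) gives `‖e‖ < ‖d‖`, which forces `e = p` and `p ∤ d`. The same comparison
gives a critical point `c` of the ball with `‖c - a‖ ≥ R / p`, all `p` roots of the ball being
closer to `a` than `c` is. Hence `(R / p) ^ p * R ^ (d - p) ≤ ‖f(c)‖ ≤ R`, that is `R ^ (d - 1) ≤ p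
^ p` (`pow_le_of_critical_values_le`). If `d = 2p`, the case `R > 1` is impossible.

The bounds are attained by `z ^ (d - p) * (z - α) ^ p` and by `(z + 1) ^ d - 1` respectively. -/

theorem norm_coeff_X_sub_C_mul_zero (F : K[X]) (a : K) :
    ‖((X - C a) * F).coeff 0‖ = ‖a‖ * ‖F.coeff 0‖ := by
  simp [mul_coeff_zero]

theorem prod_X_sub_C_comp (A : Multiset K) (a : K) :
    (A.map fun x => X - C x).prod.comp (X + C a) =
      ((A.map fun x => x - a).map fun x => X - C x).prod := by
  rw [multiset_prod_comp, Multiset.map_map, Multiset.map_map]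
  congr 1
  refine Multiset.map_congr rfl fun x _ => ?_
  simp only [Function.comp_apply, sub_comp, X_comp, C_comp, C_sub]
  ring

end NormedField

/-! ### Newton polygon estimates and the pigeonhole on balls. -/

section Ultrametric

variable {K : Type*} [NormedField K] [IsUltrametricDist K]

theorem norm_sub_le_max_norm (x y : K) : ‖x - y‖ ≤ max ‖x‖ ‖y‖ := by
  simpa [sub_eq_add_neg] using IsUltrametricDist.norm_add_le_max x (-y)

theorem norm_sub_eq_left_of_lt {x y : K} (h : ‖y‖ < ‖x‖) : ‖x - y‖ = ‖x‖ := by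
  have := IsUltrametricDist.norm_add_eq_max_of_norm_ne_norm (x := x) (y := -y)
    (by rw [norm_neg]; exact h.ne')
  rw [sub_eq_add_neg, this, norm_neg, max_eq_left h.le]

theorem norm_sub_eq_right_of_lt {x y : K} (h : ‖x‖ < ‖y‖) : ‖x - y‖ = ‖y‖ := by
  rw [norm_sub_rev, norm_sub_eq_left_of_lt h]

theorem norm_sub_lt_of_lt_of_lt {x y : K} {r : ℝ} (hx : ‖x‖ < r) (hy : ‖y‖ < r) : ‖x - y‖ < r :=
  (norm_sub_le_max_norm x y).trans_lt (max_lt hx hy)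

theorem norm_sub_le_of_le_of_le {x y : K} {r : ℝ} (hx : ‖x‖ ≤ r) (hy : ‖y‖ ≤ r) : ‖x - y‖ ≤ r :=
  (norm_sub_le_max_norm x y).trans (max_le hx hy)

/-- The coefficients of `F`, weighted at radius `ρ`, have maximal norm at `e` and
at no smaller index. -/
def IsDominantIndex (F : K[X]) (ρ : ℝ) (e : ℕ) : Prop :=
  (∀ j, ‖F.coeff j‖ * ρ ^ j ≤ ‖F.coeff e‖ * ρ ^ e) ∧
    ∀ j < e, ‖F.coeff j‖ * ρ ^ j < ‖F.coeff e‖ * ρ ^ e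

theorem norm_coeff_X_sub_C_mul_le (F : K[X]) (a : K) {ρ : ℝ} (hρ : 0 < ρ) (j : ℕ) :
    ‖((X - C a) * F).coeff (j + 1)‖ * ρ ^ (j + 1) ≤
      max (ρ * (‖F.coeff j‖ * ρ ^ j)) (‖a‖ * (‖F.coeff (j + 1)‖ * ρ ^ (j + 1))) := by
  rw [coeff_X_sub_C_mul]
  have h := norm_sub_le_max_norm (F.coeff j) (a * F.coeff (j + 1))
  calc _ ≤ max ‖F.coeff j‖ ‖a * F.coeff (j + 1)‖ * ρ ^ (j + 1) := by gcongr
    _ = _ := by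
      rw [max_mul_of_nonneg _ _ (by positivity), norm_mul]
      congr 1 <;> ring

/-- At radius `ρ` the factor `X - a` behaves like `X` when `‖a‖ < ρ`, and like the constant `-a`
when `ρ ≤ ‖a‖`; the tie falls in the second case because the dominant index is the smallest one. -/
theorem IsDominantIndex.X_sub_C_mul_of_lt {F : K[X]} {ρ : ℝ} (hρ : 0 < ρ) {e : ℕ}
    (h : IsDominantIndex F ρ e) (h0 : F.coeff e ≠ 0) {a : K} (ha : ‖a‖ < ρ) :
    ‖((X - C a) * F).coeff (e + 1)‖ = ‖F.coeff e‖ ∧ IsDominantIndex ((X - C a) * F) ρ (e + 1) := by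
  have hm : 0 < ‖F.coeff e‖ * ρ ^ e := by positivity
  have hlt : ‖a‖ * (‖F.coeff e‖ * ρ ^ e) < ρ * (‖F.coeff e‖ * ρ ^ e) := by gcongr
  have hbound : ∀ j, ‖a‖ * (‖F.coeff j‖ * ρ ^ j) < ρ * (‖F.coeff e‖ * ρ ^ e) := fun j =>
    (mul_le_mul_of_nonneg_left (h.1 j) (norm_nonneg a)).trans_lt hlt
  have he : ‖((X - C a) * F).coeff (e + 1)‖ = ‖F.coeff e‖ := by
    rw [coeff_X_sub_C_mul]
    apply norm_sub_eq_left_of_lt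
    have := hbound (e + 1)
    rw [norm_mul]
    refine lt_of_mul_lt_mul_right (a := ρ ^ (e + 1)) ?_ (by positivity)
    calc _ = ‖a‖ * (‖F.coeff (e + 1)‖ * ρ ^ (e + 1)) := by ring
      _ < _ := this
      _ = _ := by ring
  have hve : ‖((X - C a) * F).coeff (e + 1)‖ * ρ ^ (e + 1) = ρ * (‖F.coeff e‖ * ρ ^ e) := by
    rw [he]; ring
  refine ⟨he, fun j => ?_, fun j hj => ?_⟩
  · rw [hve]
    rcases j with _ | j
    · rw [norm_coeff_X_sub_C_mul_zero, mul_assoc]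
      exact (hbound 0).le
    · refine (norm_coeff_X_sub_C_mul_le F a hρ j).trans (max_le ?_ (hbound _).le)
      exact mul_le_mul_of_nonneg_left (h.1 j) hρ.le
  · rw [hve]
    rcases j with _ | j
    · rw [norm_coeff_X_sub_C_mul_zero, mul_assoc]
      exact hbound 0
    · refine (norm_coeff_X_sub_C_mul_le F a hρ j).trans_lt (max_lt ?_ (hbound _))
      exact mul_lt_mul_of_pos_left (h.2 j (by omega)) hρ

theorem IsDominantIndex.X_sub_C_mul_of_le {F : K[X]} {ρ : ℝ} (hρ : 0 < ρ) {e : ℕ}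
    (h : IsDominantIndex F ρ e) {a : K} (ha : ρ ≤ ‖a‖) :
    ‖((X - C a) * F).coeff e‖ = ‖a‖ * ‖F.coeff e‖ ∧ IsDominantIndex ((X - C a) * F) ρ e := by
  have ha0 : 0 < ‖a‖ := hρ.trans_le ha
  have hle : ρ * (‖F.coeff e‖ * ρ ^ e) ≤ ‖a‖ * (‖F.coeff e‖ * ρ ^ e) := by gcongr
  have he : ‖((X - C a) * F).coeff e‖ = ‖a‖ * ‖F.coeff e‖ := by
    rcases e with _ | e
    · exact norm_coeff_X_sub_C_mul_zero F a
    · rw [coeff_X_sub_C_mul, norm_sub_eq_right_of_lt, norm_mul]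
      rw [norm_mul]
      refine lt_of_mul_lt_mul_right (a := ρ ^ (e + 1)) ?_ (by positivity)
      calc _ = ρ * (‖F.coeff e‖ * ρ ^ e) := by ring
        _ < ρ * (‖F.coeff (e + 1)‖ * ρ ^ (e + 1)) :=
          mul_lt_mul_of_pos_left (h.2 e (by omega)) hρ
        _ ≤ _ := hle
        _ = _ := by ring
  have hve : ‖((X - C a) * F).coeff e‖ * ρ ^ e = ‖a‖ * (‖F.coeff e‖ * ρ ^ e) := by
    rw [he]; ring
  refine ⟨he, fun j => ?_, fun j hj => ?_⟩
  · rw [hve]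
    rcases j with _ | j
    · rw [norm_coeff_X_sub_C_mul_zero, mul_assoc]
      exact mul_le_mul_of_nonneg_left (h.1 0) ha0.le
    · refine (norm_coeff_X_sub_C_mul_le F a hρ j).trans (max_le ?_ ?_)
      · exact (mul_le_mul_of_nonneg_left (h.1 j) hρ.le).trans hle
      · exact mul_le_mul_of_nonneg_left (h.1 _) ha0.le
  · rw [hve]
    rcases j with _ | j
    · rw [norm_coeff_X_sub_C_mul_zero, mul_assoc]
      exact mul_lt_mul_of_pos_left (h.2 0 hj) ha0
    · refine (norm_coeff_X_sub_C_mul_le F a hρ j).trans_lt (max_lt ?_ ?_)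
      · exact (mul_lt_mul_of_pos_left (h.2 j (by omega)) hρ).trans_le hle
      · exact mul_lt_mul_of_pos_left (h.2 _ hj) ha0

open Classical in
theorem isDominantIndex_prod_X_sub_C (A : Multiset K) {ρ : ℝ} (hρ : 0 < ρ) :
    ‖(A.map fun a => X - C a).prod.coeff (A.filter fun a => ‖a‖ < ρ).card‖ =
        ((A.filter fun a => ρ ≤ ‖a‖).map fun a => ‖a‖).prod ∧
      IsDominantIndex (A.map fun a => X - C a).prod ρ (A.filter fun a => ‖a‖ < ρ).card := by
  induction A using Multiset.induction_on with
  | empty =>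
    simp only [Multiset.map_zero, Multiset.prod_zero, Multiset.filter_zero, Multiset.card_zero]
    refine ⟨by simp, fun j => ?_, fun j hj => absurd hj (by omega)⟩
    rcases j with _ | j <;> simp [coeff_one]
  | cons a A ih =>
    obtain ⟨ih1, ih2⟩ := ih
    simp only [Multiset.map_cons, Multiset.prod_cons]
    rcases lt_or_ge ‖a‖ ρ with h | h
    · rw [Multiset.filter_cons_of_pos (p := fun a => ‖a‖ < ρ) _ h,
        Multiset.filter_cons_of_neg (p := fun a => ρ ≤ ‖a‖) _ (not_le.2 h), Multiset.card_cons,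
        ← ih1]
      refine ih2.X_sub_C_mul_of_lt hρ (fun h0 => ?_) h
      rw [h0, norm_zero, eq_comm, Multiset.prod_eq_zero_iff, Multiset.mem_map] at ih1
      obtain ⟨b, hb, hb0⟩ := ih1
      rw [Multiset.mem_filter] at hb
      linarith [hb.2]
    · rw [Multiset.filter_cons_of_neg (p := fun a => ‖a‖ < ρ) _ (not_lt.2 h),
        Multiset.filter_cons_of_pos (p := fun a => ρ ≤ ‖a‖) _ h, Multiset.map_cons,
        Multiset.prod_cons, ← ih1]
      exact ih2.X_sub_C_mul_of_le hρ h

-- The Gauss norm at radius `ρ` is submultiplicative, and each factor contributes `max ρ ‖b‖`.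
open Classical in
theorem norm_coeff_prod_X_sub_C_le (B : Multiset K) {ρ R : ℝ} (hρ : 0 < ρ) (hρR : ρ ≤ R)
    (hB : ∀ b ∈ B, ‖b‖ ≤ R) (k : ℕ) :
    ‖(B.map fun b => X - C b).prod.coeff k‖ * ρ ^ k ≤
      ρ ^ (B.filter fun b => ‖b‖ ≤ ρ).card * R ^ (B.filter fun b => ¬ ‖b‖ ≤ ρ).card := by
  induction B using Multiset.induction_on generalizing k with
  | empty => rcases k with _ | k <;> simp [coeff_one]
  | cons b B ih =>
    have ih := ih fun x hx => hB x (Multiset.mem_cons_of_mem hx)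
    have hb := hB b (Multiset.mem_cons_self b B)
    simp only [Multiset.map_cons, Multiset.prod_cons]
    have hR : 0 < R := hρ.trans_le hρR
    set M := ρ ^ (B.filter fun b => ‖b‖ ≤ ρ).card * R ^ (B.filter fun b => ¬ ‖b‖ ≤ ρ).card
      with hM
    have hM0 : 0 ≤ M := by positivity
    have key : ‖((X - C b) * (B.map fun b => X - C b).prod).coeff k‖ * ρ ^ k ≤ max ρ ‖b‖ * M := by
      rcases k with _ | k
      · rw [norm_coeff_X_sub_C_mul_zero, mul_assoc]
        exact mul_le_mul (le_max_right _ _) (ih 0) (by positivity) (by positivity)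
      · refine (norm_coeff_X_sub_C_mul_le _ b hρ k).trans (max_le ?_ ?_)
        · exact mul_le_mul (le_max_left _ _) (ih k) (by positivity) (by positivity)
        · exact mul_le_mul (le_max_right _ _) (ih _) (by positivity) (by positivity)
    refine key.trans ?_
    by_cases h : ‖b‖ ≤ ρ
    · rw [Multiset.filter_cons_of_pos (p := fun b => ‖b‖ ≤ ρ) _ h,
        Multiset.filter_cons_of_neg (p := fun b => ¬ ‖b‖ ≤ ρ) _ (not_not.2 h),
        Multiset.card_cons, max_eq_left h, hM]
      exact le_of_eq (by ring)
    · rw [Multiset.filter_cons_of_neg (p := fun b => ‖b‖ ≤ ρ) _ h,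
        Multiset.filter_cons_of_pos (p := fun b => ¬ ‖b‖ ≤ ρ) _ h,
        Multiset.card_cons, max_eq_right (not_le.1 h).le]
      calc _ ≤ R * M := by gcongr
        _ = _ := by rw [hM]; ring

open Classical in
/-- The comparison between the roots `A` of a monic polynomial near `a` and the roots `B` of its
derivative near `a`. -/
theorem norm_card_mul_prod_le {A B : Multiset K} {δ : K}
    (hder : derivative (A.map fun x => X - C x).prod = C δ * (B.map fun x => X - C x).prod)
    (a : K) {r ρ R : ℝ} (hr : 0 < r) (hρ : 0 < ρ) (hρR : ρ ≤ R)
    (hB : ∀ b ∈ B, ‖b - a‖ ≤ R) {e : ℕ} (he : (A.filter fun x => ‖x - a‖ < r).card = e + 1) :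
    ‖((e + 1 : ℕ) : K)‖ * ((A.filter fun x => r ≤ ‖x - a‖).map fun x => ‖x - a‖).prod * ρ ^ e ≤
      ‖δ‖ * (ρ ^ (B.filter fun b => ‖b - a‖ ≤ ρ).card *
        R ^ (B.filter fun b => ¬ ‖b - a‖ ≤ ρ).card) := by
  -- After recentring at `a`, coefficient `e` of the derivative is `e + 1` times coefficient `e + 1`
  -- of the polynomial, whose norm is exactly the product over the outer roots.
  have hder' : derivative ((A.map fun x => x - a).map fun x => X - C x).prod =
      C δ * ((B.map fun x => x - a).map fun x => X - C x).prod := by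
    rw [← prod_X_sub_C_comp, ← prod_X_sub_C_comp, derivative_comp, hder]
    simp
  have hc := congrArg (fun F => ‖F.coeff e‖) hder'
  simp only [coeff_derivative, coeff_C_mul, norm_mul] at hc
  have h1 := (isDominantIndex_prod_X_sub_C (A.map fun x => x - a) hr).1
  have h2 := norm_coeff_prod_X_sub_C_le (B.map fun x => x - a) hρ hρR (by simpa using hB) e
  simp only [Multiset.filter_map, Multiset.card_map, Multiset.map_map, Function.comp_def] at h1 h2
  rw [he] at h1
  simp only [Multiset.map_map, Function.comp_def] at hc
  rw [h1] at hc
  push_cast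
  rw [mul_comm ‖(e + 1 : K)‖, hc, mul_assoc]
  gcongr

open Classical in
/-- Pigeonhole: if `A` meets at least two of the open balls of radius `R`, and `B` has fewer
elements than `A`, all close to `A`, then some ball has at least as many elements of `B` as of
`A`. -/
theorem exists_card_filter_le {A B : Multiset K} {R : ℝ} (hcard : B.card + 1 = A.card)
    (hB : ∀ b ∈ B, ∃ a ∈ A, ‖b - a‖ < R) {x y : K} (hx : x ∈ A) (hy : y ∈ A) (hR : 0 < R)
    (hxy : R ≤ ‖x - y‖) :
    ∃ a ∈ A, (A.filter fun z => ‖z - a‖ < R).card ≤ (B.filter fun z => ‖z - a‖ < R).card := by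
  by_contra! hcon
  have hball : ∀ z a : K, Metric.ball a R = Metric.ball z R ↔ ‖z - a‖ < R := by
    intro z a
    rw [← dist_eq_norm]
    constructor
    · intro h
      have := Metric.mem_ball_self (x := z) hR
      rwa [← h] at this
    · intro h
      exact IsUltrametricDist.ball_eq_of_mem h
  set A' := A.map fun z => Metric.ball z R with hA'
  set B' := B.map fun z => Metric.ball z R with hB'
  have hcA : ∀ a, A'.count (Metric.ball a R) = (A.filter fun z => ‖z - a‖ < R).card := by
    intro a
    rw [hA', Multiset.count_map]
    simp only [hball]
  have hcB : ∀ a, B'.count (Metric.ball a R) = (B.filter fun z => ‖z - a‖ < R).card := by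
    intro a
    rw [hB', Multiset.count_map]
    simp only [hball]
  have hlt : ∀ s ∈ A'.toFinset, B'.count s + 1 ≤ A'.count s := by
    intro s hs
    rw [Multiset.mem_toFinset, hA', Multiset.mem_map] at hs
    obtain ⟨a, ha, rfl⟩ := hs
    rw [hcA, hcB]
    exact hcon a ha
  have hsumA : ∑ s ∈ A'.toFinset, A'.count s = A.card := by
    rw [Multiset.toFinset_sum_count_eq, hA', Multiset.card_map]
  have hsumB : ∑ s ∈ A'.toFinset, B'.count s = B.card := by
    rw [Multiset.sum_count_eq_card, hB', Multiset.card_map]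
    intro s hs
    rw [hB', Multiset.mem_map] at hs
    obtain ⟨b, hb, rfl⟩ := hs
    obtain ⟨a, ha, hab⟩ := hB b hb
    rw [Multiset.mem_toFinset, hA', Multiset.mem_map]
    exact ⟨a, ha, (hball b a).2 hab⟩
  have htwo : 1 < A'.toFinset.card := by
    rw [Finset.one_lt_card]
    refine ⟨Metric.ball x R, ?_, Metric.ball y R, ?_, ?_⟩
    · exact Multiset.mem_toFinset.2 (Multiset.mem_map_of_mem _ hx)
    · exact Multiset.mem_toFinset.2 (Multiset.mem_map_of_mem _ hy)
    · rw [Ne, hball, norm_sub_rev]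
      exact not_lt.2 hxy
  -- A deficit of at least one in each of at least two balls would give `B.card + 2 ≤ A.card`.
  have := Finset.sum_le_sum hlt
  rw [Finset.sum_add_distrib, hsumA, hsumB, Finset.sum_const, smul_eq_mul, mul_one] at this
  omega

end Ultrametric

/-! ### Bounding the diameter of the root set. -/

section RootRadius

variable {K : Type*}

theorem pow_card_le_prod_map (S : Multiset K) (f : K → ℝ) {c : ℝ} (hc : 0 ≤ c)
    (h : ∀ x ∈ S, c ≤ f x) : c ^ S.card ≤ (S.map f).prod := by
  have := Multiset.prod_map_le_prod_map₀ (s := S) (fun _ => c) f (fun _ _ => hc) h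
  simpa using this

open Classical in
theorem pow_card_mul_pow_card_le_prod_map (S : Multiset K) (P : K → Prop) (f : K → ℝ) {b c : ℝ}
    (hb : 0 ≤ b) (hc : 0 ≤ c) (hP : ∀ x ∈ S, P x → b ≤ f x) (hP' : ∀ x ∈ S, ¬ P x → c ≤ f x) :
    b ^ (S.filter P).card * c ^ (S.filter fun x => ¬ P x).card ≤ (S.map f).prod := by
  conv_rhs => rw [← Multiset.filter_add_not P S, Multiset.map_add, Multiset.prod_add]
  have h1 := pow_card_le_prod_map (S.filter P) f hb fun x hx => by
    rw [Multiset.mem_filter] at hx; exact hP x hx.1 hx.2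
  have h2 := pow_card_le_prod_map (S.filter fun x => ¬ P x) f hc fun x hx => by
    rw [Multiset.mem_filter] at hx; exact hP' x hx.1 hx.2
  exact mul_le_mul h1 h2 (by positivity) ((pow_nonneg hb _).trans h1)

open Classical in
theorem card_filter_add_card_filter_not (S : Multiset K) (P : K → Prop) :
    (S.filter P).card + (S.filter fun x => ¬ P x).card = S.card := by
  rw [← Multiset.card_add, Multiset.filter_add_not]

open Classical in
theorem exists_max_norm_sub [NormedField K] (S : Multiset K) (a : K) {x : K} (hx : x ∈ S) :
    ∃ y ∈ S, ∀ z ∈ S, ‖z - a‖ ≤ ‖y - a‖ := by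
  obtain ⟨y, hy, h⟩ := S.toFinset.exists_max_image (fun z => ‖z - a‖)
    ⟨x, Multiset.mem_toFinset.2 hx⟩
  exact ⟨y, Multiset.mem_toFinset.1 hy, fun z hz => h z (Multiset.mem_toFinset.2 hz)⟩

variable [NormedField K] [IsUltrametricDist K]

-- Roots at distance in `[r, R)` from `a` count for at least `ρ`, farther ones for at least `R`. As
-- the ball has no fewer critical points than roots, the right side of `norm_card_mul_prod_le` has
-- at least one more factor `ρ` than the left, and cancelling leaves `R` against `ρ`.
open Classical in
theorem norm_card_filter_mul_le {A B : Multiset K} {δ : K} (hcard : B.card + 1 = A.card)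
    (hder : derivative (A.map fun x => X - C x).prod = C δ * (B.map fun x => X - C x).prod)
    {a : K} (ha : a ∈ A) {r ρ R : ℝ} (hρ : 0 < ρ) (hρr : ρ ≤ r) (hrR : r ≤ R) (hρR : ρ < R)
    (hBR : ∀ b ∈ B, ‖b - a‖ ≤ R) (hBρ : ∀ b ∈ B, ‖b - a‖ < R → ‖b - a‖ ≤ ρ)
    (hle : (A.filter fun x => ‖x - a‖ < R).card ≤ (B.filter fun x => ‖x - a‖ < R).card) :
    ‖((A.filter fun x => ‖x - a‖ < r).card : K)‖ * R ≤ ‖δ‖ * ρ := by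
  have hr : 0 < r := hρ.trans_le hρr
  have hR : 0 < R := hρ.trans hρR
  have hpos : 0 < (A.filter fun x => ‖x - a‖ < r).card :=
    Multiset.card_pos_iff_exists_mem.2 ⟨a, Multiset.mem_filter.2 ⟨ha, by simpa using hr⟩⟩
  obtain ⟨k, hk⟩ := Nat.exists_eq_succ_of_ne_zero hpos.ne'
  have key := norm_card_mul_prod_le hder a hr hρ hρR.le hBR hk
  rw [hk]
  have hBfilter : (B.filter fun b => ‖b - a‖ ≤ ρ) = B.filter fun b => ‖b - a‖ < R :=
    Multiset.filter_congr fun b hb => ⟨fun h => h.trans_lt hρR, hBρ b hb⟩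
  have hN := card_filter_add_card_filter_not B fun b => ‖b - a‖ ≤ ρ
  rw [← hBfilter] at hle
  have hlow := pow_card_mul_pow_card_le_prod_map (A.filter fun x => r ≤ ‖x - a‖)
    (fun x => ‖x - a‖ < R) (fun x => ‖x - a‖) hρ.le hR.le
    (fun x hx _ => hρr.trans (Multiset.mem_filter.1 hx).2) (fun x _ hx => not_lt.1 hx)
  have hAr := card_filter_add_card_filter_not A fun x => ‖x - a‖ < r
  have hAR := card_filter_add_card_filter_not A fun x => ‖x - a‖ < R
  simp only [not_lt] at hAr hAR hlow
  have hArR := card_filter_add_card_filter_not (A.filter fun x => r ≤ ‖x - a‖)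
    fun x => ‖x - a‖ < R
  simp only [not_lt] at hArR
  have hout : ((A.filter fun x => r ≤ ‖x - a‖).filter fun x => R ≤ ‖x - a‖) =
      A.filter fun x => R ≤ ‖x - a‖ := by
    rw [Multiset.filter_filter]
    exact Multiset.filter_congr fun x _ => ⟨fun h => h.1, fun h => ⟨h, hrR.trans h⟩⟩
  rw [hout] at hlow hArR
  set m := ((A.filter fun x => r ≤ ‖x - a‖).filter fun x => ‖x - a‖ < R).card
  set n := (A.filter fun x => R ≤ ‖x - a‖).card
  set q := (B.filter fun b => ¬ ‖b - a‖ ≤ ρ).card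
  set N := (B.filter fun b => ‖b - a‖ ≤ ρ).card
  -- `s` is the surplus of critical points over roots in the ball; its factor `ρ ^ s` is bounded by
  -- `R ^ s`.
  obtain ⟨s, hs⟩ : ∃ s, N = k + m + 1 + s := ⟨N - (k + m + 1), by omega⟩
  have hn : n = s + q + 1 := by omega
  have hfin : ‖((k + 1 : ℕ) : K)‖ * R * (ρ ^ (k + m) * R ^ (s + q)) ≤
      ‖δ‖ * ρ * (ρ ^ (k + m) * R ^ (s + q)) := by
    calc _ = ‖((k + 1 : ℕ) : K)‖ * (ρ ^ m * R ^ n) * ρ ^ k := by rw [hn]; ring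
      _ ≤ _ := by gcongr
      _ ≤ ‖δ‖ * (ρ ^ N * R ^ q) := key
      _ = ‖δ‖ * (ρ ^ (k + m + 1) * ρ ^ s * R ^ q) := by rw [hs]; ring
      _ ≤ ‖δ‖ * (ρ ^ (k + m + 1) * R ^ s * R ^ q) := by gcongr
      _ = _ := by ring
  exact le_of_mul_le_mul_right hfin (by positivity)

open Classical in
/-- If the roots `A` of a monic polynomial have diameter `R > 1`, and its values at its critical
points `B` have norm at most `R`, then `R ^ (d - 1) ≤ p ^ p`. -/
theorem pow_le_of_critical_values_le [CharZero K] {p d : ℕ} (hp : p.Prime)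
    (hunit : ∀ n : ℕ, ¬ p ∣ n → ‖(n : K)‖ = 1) (hnorm : ‖(p : K)‖ = (p : ℝ)⁻¹)
    (hpd : p < d) (hdp : d ≤ 2 * p) {A B : Multiset K} (hA : A.card = d) (hB : B.card + 1 = d)
    (hder : derivative (A.map fun x => X - C x).prod =
      C (d : K) * (B.map fun x => X - C x).prod)
    {R : ℝ} (hR : 1 < R) (hAR : ∀ x ∈ A, ‖x‖ ≤ R) {x y : K} (hx : x ∈ A) (hy : y ∈ A)
    (hxy : R ≤ ‖x - y‖) (hval : ∀ b ∈ B, (A.map fun x => ‖b - x‖).prod ≤ R) :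
    ¬ p ∣ d ∧ R ^ (d - 1) ≤ (p : ℝ) ^ p := by
  have hR0 : 0 < R := one_pos.trans hR
  have hp2 := hp.two_le
  have hclose : ∀ b ∈ B, ∃ a ∈ A, ‖b - a‖ < R := by
    intro b hb
    by_contra! hcon
    have h1 := (pow_card_le_prod_map A (fun x => ‖b - x‖) hR0.le hcon).trans (hval b hb)
    rw [hA] at h1
    have h2 : R ^ 1 < R ^ d := pow_lt_pow_right₀ hR (by omega)
    linarith
  have hBR : ∀ b ∈ B, ‖b‖ ≤ R := by
    intro b hb
    obtain ⟨a, ha, hba⟩ := hclose b hb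
    have := norm_sub_le_of_le_of_le hba.le (by rw [norm_neg]; exact hAR a ha : ‖-a‖ ≤ R)
    simpa using this
  obtain ⟨a, ha, hle⟩ := exists_card_filter_le (hB.trans hA.symm) hclose hx hy hR0 hxy
  have hAa : ∀ z ∈ A, ‖z - a‖ ≤ R := fun z hz => norm_sub_le_of_le_of_le (hAR z hz) (hAR a ha)
  have hBa : ∀ z ∈ B, ‖z - a‖ ≤ R := fun z hz => norm_sub_le_of_le_of_le (hBR z hz) (hAR a ha)
  set e := (A.filter fun z => ‖z - a‖ < R).card with he
  have he0 : 0 < e :=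
    Multiset.card_pos_iff_exists_mem.2 ⟨a, Multiset.mem_filter.2 ⟨ha, by simpa using hR0⟩⟩
  have hed : e < d := by
    have h := card_filter_add_card_filter_not A fun z => ‖z - a‖ < R
    have : 0 < (A.filter fun z => ¬ ‖z - a‖ < R).card := by
      rw [Multiset.card_pos_iff_exists_mem]
      by_contra! hcon
      have hin : ∀ z ∈ A, ‖z - a‖ < R := fun z hz => by
        by_contra! hz'
        exact hcon z (Multiset.mem_filter.2 ⟨hz, hz'⟩)
      have := norm_sub_lt_of_lt_of_lt (hin x hx) (hin y hy)
      rw [sub_sub_sub_cancel_right] at this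
      linarith
    omega
  obtain ⟨b, hb⟩ := Multiset.card_pos_iff_exists_mem.1 (he0.trans_le hle)
  obtain ⟨c, hc, hcmax⟩ := exists_max_norm_sub _ a hb
  rw [Multiset.mem_filter] at hc
  obtain ⟨hcB, hcR⟩ := hc
  have hcmax : ∀ z ∈ B, ‖z - a‖ < R → ‖z - a‖ ≤ ‖c - a‖ := fun z hz hzR =>
    hcmax z (Multiset.mem_filter.2 ⟨hz, hzR⟩)
  -- `ρ` is taken above `‖c - a‖`, which might still be 0.
  have houter : ∀ ρ, ‖c - a‖ < ρ → ρ < R → ‖(e : K)‖ * R ≤ ‖(d : K)‖ * ρ := fun ρ h1 h2 =>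
    norm_card_filter_mul_le (hB.trans hA.symm) hder ha ((norm_nonneg _).trans_lt h1) h2.le le_rfl
      h2 hBa (fun z hz hzR => (hcmax z hz hzR).trans h1.le) hle
  have hd0 : 0 < ‖(d : K)‖ := norm_pos_iff.2 (Nat.cast_ne_zero.2 (by omega))
  have hed' : ‖(e : K)‖ < ‖(d : K)‖ := by
    obtain ⟨ρ, h1, h2⟩ := exists_between hcR
    have h3 := houter ρ h1 h2
    refine lt_of_mul_lt_mul_right (a := R) ?_ hR0.le
    calc _ ≤ _ := h3
      _ < _ := mul_lt_mul_of_pos_left h2 hd0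
  have hpe : e = p := by
    have hdvd : p ∣ e := by
      by_contra h
      have h1 := IsUltrametricDist.norm_natCast_le_one K d
      rw [hunit e h] at hed'
      linarith
    obtain ⟨k, hk⟩ := hdvd
    have hk0 : 0 < k := Nat.pos_of_ne_zero fun h => by simp [h] at hk; omega
    have hk2 : k < 2 := by
      by_contra! h
      have : p * 2 ≤ p * k := Nat.mul_le_mul_left p h
      omega
    have : k = 1 := by omega
    rw [hk, this, mul_one]
  have hpnd : ¬ p ∣ d := by
    rintro ⟨k, hk⟩
    rw [hpe, hk, Nat.cast_mul, norm_mul] at hed'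
    have h1 := IsUltrametricDist.norm_natCast_le_one K k
    nlinarith [norm_nonneg (p : K)]
  refine ⟨hpnd, ?_⟩
  have hp0 : (0 : ℝ) < p := by exact_mod_cast hp.pos
  have hcp : R ≤ p * ‖c - a‖ := by
    by_contra! h
    have h' : ‖c - a‖ < R / p := by rwa [lt_div_iff₀ hp0, mul_comm]
    obtain ⟨ρ, h1, h2⟩ := exists_between h'
    have hRp : R / p ≤ R := div_le_self hR0.le (by exact_mod_cast hp.one_lt.le)
    have h3 := houter ρ h1 (h2.trans_le hRp)
    rw [hpe, hnorm, hunit d hpnd, one_mul, mul_comm, ← div_eq_mul_inv] at h3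
    linarith
  have hc0 : 0 < ‖c - a‖ := by
    by_contra! h
    nlinarith
  -- Otherwise take the farthest root `u` of the ball: strictly inside radius `‖u - a‖` there are
  -- between 1 and `p - 1` roots, a unit count, and the comparison gives `R ≤ ‖u - a‖`.
  have hin : ∀ z ∈ A, ‖z - a‖ < R → ‖z - a‖ < ‖c - a‖ := by
    by_contra! hcon
    obtain ⟨w, hw, hwR, hcw⟩ := hcon
    obtain ⟨u, hu, humax⟩ := exists_max_norm_sub (A.filter fun z => ‖z - a‖ < R) a
      (Multiset.mem_filter.2 ⟨hw, hwR⟩)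
    have hcu := hcw.trans (humax w (Multiset.mem_filter.2 ⟨hw, hwR⟩))
    have huR := (Multiset.mem_filter.1 hu).2
    have hu0 := hc0.trans_le hcu
    have h1 := norm_card_filter_mul_le (hB.trans hA.symm) hder ha hu0 le_rfl huR.le huR hBa
      (fun z hz hzR => (hcmax z hz hzR).trans hcu) hle
    have hsub : (A.filter fun z => ‖z - a‖ < ‖u - a‖) < A.filter fun z => ‖z - a‖ < R := by
      refine lt_of_le_of_ne
        (Multiset.monotone_filter_right A fun z h => h.trans huR) fun h => ?_
      rw [← h, Multiset.mem_filter] at hu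
      exact lt_irrefl _ hu.2
    have hlt := Multiset.card_lt_card hsub
    have hpos : 0 < (A.filter fun z => ‖z - a‖ < ‖u - a‖).card :=
      Multiset.card_pos_iff_exists_mem.2 ⟨a, Multiset.mem_filter.2 ⟨ha, by simpa using hu0⟩⟩
    rw [← he, hpe] at hlt
    rw [hunit _ (Nat.not_dvd_of_pos_of_lt hpos hlt), hunit d hpnd] at h1
    linarith
  have hlow := pow_card_mul_pow_card_le_prod_map A (fun z => ‖z - a‖ < R) (fun z => ‖c - z‖)
    hc0.le hR0.le
    (fun z hz hzR => by
      have := norm_sub_eq_left_of_lt (hin z hz hzR)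
      rw [sub_sub_sub_cancel_right] at this
      exact this.ge)
    (fun z hz hzR => by
      have hzR := not_lt.1 hzR
      have := norm_sub_eq_right_of_lt (hcR.trans_le hzR)
      rw [sub_sub_sub_cancel_right] at this
      exact hzR.trans this.ge)
  have hcard := card_filter_add_card_filter_not A fun z => ‖z - a‖ < R
  rw [← he, hpe, hA] at hcard
  rw [← he, hpe] at hlow
  set n := (A.filter fun z => ¬ ‖z - a‖ < R).card
  have hv := hlow.trans (hval c hcB)
  have h1 : R * R ^ (d - 1) ≤ R * (p : ℝ) ^ p := by
    calc R * R ^ (d - 1) = R ^ p * R ^ n := by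
          rw [← pow_succ', ← pow_add]; congr 1; omega
      _ ≤ (p * ‖c - a‖) ^ p * R ^ n := by gcongr
      _ = (p : ℝ) ^ p * (‖c - a‖ ^ p * R ^ n) := by ring
      _ ≤ (p : ℝ) ^ p * R := by gcongr
      _ = _ := mul_comm _ _
  exact le_of_mul_le_mul_left h1 hR0

end RootRadius

/-! ### Escape radius, critical points and extremal polynomials. -/

section Dynamics

variable {p : ℕ} [Fact p.Prime]

theorem norm_natCast_eq (n : ℕ) : ‖(n : ℂ_[p])‖ = ‖(n : ℚ_[p])‖ := by
  rw [← PadicComplex.norm_extends' p (n : ℚ_[p])]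
  simp

theorem norm_natCast_eq_one {n : ℕ} (h : ¬ p ∣ n) : ‖(n : ℂ_[p])‖ = 1 := by
  rw [norm_natCast_eq, Padic.norm_natCast_eq_one_iff]
  exact ((Fact.out : p.Prime).coprime_iff_not_dvd).2 h

theorem norm_natCast_prime : ‖(p : ℂ_[p])‖ = (p : ℝ)⁻¹ := by
  rw [norm_natCast_eq, Padic.norm_p]

theorem neg_val_of_ne_zero {x : ℂ_[p]} (hx : x ≠ 0) :
    -val p x = ((Real.logb p ‖x‖ : ℝ) : EReal) := by
  rw [val, if_neg hx, ← EReal.coe_neg, neg_neg]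

theorem neg_val_le {x : ℂ_[p]} {t : ℝ} (h : x ≠ 0 → Real.logb p ‖x‖ ≤ t) : -val p x ≤ (t : EReal) := by
  rcases eq_or_ne x 0 with rfl | hx
  · simp [val]
  · rw [neg_val_of_ne_zero hx]
    exact EReal.coe_le_coe_iff.2 (h hx)

theorem eq_prod_roots {f : ℂ_[p][X]} (hf : f.Monic) : f = (f.roots.map fun x => X - C x).prod :=
  (IsAlgClosed.splits f).eq_prod_roots_of_monic hf

theorem norm_eval_eq_prod {f : ℂ_[p][X]} (hf : f.Monic) (z : ℂ_[p]) :
    ‖f.eval z‖ = (f.roots.map fun x => ‖z - x‖).prod := by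
  conv_lhs => rw [eq_prod_roots hf]
  rw [eval_multiset_prod, Multiset.map_map]
  have := map_multiset_prod (normHom : ℂ_[p] →*₀ ℝ)
    (f.roots.map (Polynomial.eval z ∘ fun x => X - C x))
  simp only [normHom_apply] at this
  rw [this, Multiset.map_map]
  simp [Function.comp_def]

theorem norm_eval_of_lt {f : ℂ_[p][X]} (hf : f.Monic) {R : ℝ} (hR : ∀ x ∈ f.roots, ‖x‖ ≤ R)
    {z : ℂ_[p]} (hz : R < ‖z‖) : ‖f.eval z‖ = ‖z‖ ^ f.natDegree := by
  rw [norm_eval_eq_prod hf, (IsAlgClosed.splits f).natDegree_eq_card_roots,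
    Multiset.map_congr rfl fun x hx => norm_sub_eq_left_of_lt ((hR x hx).trans_lt hz)]
  simp

/-- Beyond every root `‖f(z)‖ = ‖z‖ ^ d` with `d ≥ 2`, so an orbit starting at norm above `R ≥ 1`
grows without bound. -/
theorem norm_le_of_isBounded_orbit {f : ℂ_[p][X]} (hf : f.Monic) (hd : 2 ≤ f.natDegree) {R : ℝ}
    (hR1 : 1 ≤ R) (hR : ∀ x ∈ f.roots, ‖x‖ ≤ R) {z : ℂ_[p]}
    (hz : Bornology.IsBounded (Set.range fun n : ℕ => (fun z : ℂ_[p] => f.eval z)^[n] z)) :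
    ‖z‖ ≤ R := by
  by_contra! hlt
  have hz1 : 1 < ‖z‖ := hR1.trans_lt hlt
  have hgrow : ∀ n : ℕ, ‖z‖ ^ (n + 1) ≤ ‖(fun z : ℂ_[p] => f.eval z)^[n] z‖ := by
    intro n
    induction n with
    | zero => simp
    | succ n ih =>
      rw [Function.iterate_succ_apply']
      set w := (fun z : ℂ_[p] => f.eval z)^[n] z
      have hw : ‖z‖ ≤ ‖w‖ := (le_self_pow₀ hz1.le (by omega)).trans ih
      rw [norm_eval_of_lt hf hR (hlt.trans_le hw)]
      calc ‖z‖ ^ (n + 1 + 1) ≤ ‖z‖ ^ ((n + 1) * 2) := pow_le_pow_right₀ hz1.le (by omega)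
        _ = (‖z‖ ^ (n + 1)) ^ 2 := pow_mul _ _ _
        _ ≤ ‖w‖ ^ 2 := by gcongr
        _ ≤ _ := pow_le_pow_right₀ (hz1.le.trans hw) hd
  obtain ⟨M, hM⟩ := hz.exists_norm_le
  obtain ⟨n, hn⟩ := pow_unbounded_of_one_lt M hz1
  have h1 := hM _ ⟨n, rfl⟩
  have h2 : ‖z‖ ^ n ≤ ‖z‖ ^ (n + 1) := pow_le_pow_right₀ hz1.le (by omega)
  have h3 := hgrow n
  linarith

theorem isBounded_orbit_eval {f : ℂ_[p][X]} {z : ℂ_[p]}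
    (hz : Bornology.IsBounded (Set.range fun n : ℕ => (fun z : ℂ_[p] => f.eval z)^[n] z)) :
    Bornology.IsBounded
      (Set.range fun n : ℕ => (fun z : ℂ_[p] => f.eval z)^[n] (f.eval z)) := by
  refine hz.subset ?_
  rintro _ ⟨n, rfl⟩
  exact ⟨n + 1, rfl⟩

theorem norm_critPoint_le {d : ℕ} (hpd : p < d) (hdp : d ≤ 2 * p) {f : ℂ_[p][X]}
    (hf : f ∈ mandelbrotSet d p) {c : ℂ_[p]} (hc : c ∈ critPoints f) :
    ‖c‖ ≤ 1 ∨ (¬ p ∣ d ∧ ‖c‖ ^ (d - 1) ≤ (p : ℝ) ^ p) := by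
  have hp : p.Prime := Fact.out
  obtain ⟨⟨hmon, hdeg, hf0⟩, hpcb⟩ := hf
  have hd2 : 2 ≤ f.natDegree := by have := hp.two_le; omega
  have h0 : (0 : ℂ_[p]) ∈ f.roots := (mem_roots hmon.ne_zero).2 hf0
  obtain ⟨y, hy, hmax⟩ := exists_max_norm_sub f.roots 0 h0
  simp only [sub_zero] at hmax
  rcases le_or_gt ‖y‖ 1 with hy1 | hy1
  · exact Or.inl (norm_le_of_isBounded_orbit hmon hd2 le_rfl (fun x hx => (hmax x hx).trans hy1)
      (hpcb c hc))
  right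
  have hder0 : derivative f ≠ 0 := by
    intro h
    have := leadingCoeff_derivative f
    rw [h, leadingCoeff_zero, hmon.leadingCoeff, one_mul, eq_comm, Nat.cast_eq_zero] at this
    omega
  have hder : derivative f = C (d : ℂ_[p]) * ((derivative f).roots.map fun x => X - C x).prod := by
    have h := (IsAlgClosed.splits (derivative f)).eq_prod_roots
    rwa [leadingCoeff_derivative, hmon.leadingCoeff, one_mul, hdeg] at h
  have hcardA : f.roots.card = d := by
    rw [← (IsAlgClosed.splits f).natDegree_eq_card_roots, hdeg]
  have hcardB : (derivative f).roots.card + 1 = d := by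
    rw [← (IsAlgClosed.splits _).natDegree_eq_card_roots, natDegree_derivative]
    omega
  have hbdd : ∀ b ∈ (derivative f).roots, b ∈ critPoints f := fun b hb =>
    (mem_roots hder0).1 hb
  obtain ⟨h1, h2⟩ := pow_le_of_critical_values_le hp (fun n => norm_natCast_eq_one)
    norm_natCast_prime hpd hdp hcardA hcardB (by rw [← eq_prod_roots hmon]; exact hder) hy1 hmax hy h0
    (by rw [sub_zero]) (fun b hb => by
      rw [← norm_eval_eq_prod hmon]
      exact norm_le_of_isBounded_orbit hmon hd2 hy1.le hmax
        (isBounded_orbit_eval (hpcb b (hbdd b hb))))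
  have hcy := norm_le_of_isBounded_orbit hmon hd2 hy1.le hmax (hpcb c hc)
  exact ⟨h1, (by gcongr : ‖c‖ ^ (d - 1) ≤ ‖y‖ ^ (d - 1)).trans h2⟩

theorem critRadius_le {d : ℕ} {t : ℝ}
    (h : ∀ f ∈ mandelbrotSet d p, ∀ c ∈ critPoints f, c ≠ 0 → Real.logb p ‖c‖ ≤ t) :
    critRadius d p ≤ (t : EReal) :=
  iSup₂_le fun f hf => iSup₂_le fun c hc => neg_val_le (h f hf c hc)

theorem le_critRadius {d : ℕ} {f : ℂ_[p][X]} (hf : f ∈ mandelbrotSet d p) {c : ℂ_[p]}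
    (hc : c ∈ critPoints f) (hc0 : c ≠ 0) :
    ((Real.logb p ‖c‖ : ℝ) : EReal) ≤ critRadius d p := by
  rw [← neg_val_of_ne_zero hc0]
  exact le_iSup₂_of_le f hf (le_iSup₂_of_le c hc le_rfl)

/-- The polynomial `(z + 1) ^ d - 1`, whose only critical point `-1` is fixed. -/
theorem X_add_one_pow_sub_one_mem_mandelbrotSet {d : ℕ} (hd : 2 ≤ d) :
    (X + C 1 : ℂ_[p][X]) ^ d - C 1 ∈ mandelbrotSet d p := by
  have hmon : ((X + C 1 : ℂ_[p][X]) ^ d).Monic := (monic_X_add_C 1).pow d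
  have hdeg : ((X + C 1 : ℂ_[p][X]) ^ d).natDegree = d := by
    rw [natDegree_pow_X_add_C]
  refine ⟨⟨?_, ?_, ?_⟩, fun c hc => ?_⟩
  · refine hmon.sub_of_left ?_
    rw [degree_eq_natDegree hmon.ne_zero, hdeg]
    exact degree_C_le.trans_lt (by exact_mod_cast (by omega : 0 < d))
  · rw [natDegree_sub_C, hdeg]
  · simp
  · have hc' : c = -1 := by
      have h : (d : ℂ_[p]) * (c + 1) ^ (d - 1) = 0 := by
        simpa [critPoints, derivative_pow] using hc
      have hd0 : (d : ℂ_[p]) ≠ 0 := Nat.cast_ne_zero.2 (by omega)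
      exact eq_neg_of_add_eq_zero_left
        ((pow_eq_zero_iff (by omega)).1 ((mul_eq_zero.1 h).resolve_left hd0))
    subst hc'
    refine (Set.finite_singleton (-1 : ℂ_[p])).isBounded.subset ?_
    rintro _ ⟨n, rfl⟩
    refine Function.iterate_fixed ?_ n
    simp [show d ≠ 0 by omega]

theorem isBounded_orbit_of_eval_eval_eq_zero {f : ℂ_[p][X]} (h0 : f.eval 0 = 0) {c : ℂ_[p]}
    (hc : f.eval (f.eval c) = 0) :
    Bornology.IsBounded (Set.range fun n : ℕ => (fun z : ℂ_[p] => f.eval z)^[n] c) := by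
  refine (Set.toFinite {c, f.eval c, 0}).isBounded.subset ?_
  rintro _ ⟨n, rfl⟩
  rcases n with _ | _ | n
  · simp
  · simp
  · have : (fun z : ℂ_[p] => f.eval z)^[n + 2] c = 0 := by
      rw [Function.iterate_add_apply]
      simp only [Function.iterate_succ, Function.iterate_zero, Function.comp_apply, id, hc]
      exact Function.iterate_fixed h0 n
    simp [this]

theorem eval_derivative_X_pow_mul_X_sub_C_pow {R : Type*} [CommRing R] {m n : ℕ} (hm : m ≠ 0)
    (hn : n ≠ 0) (a c : R) :
    (derivative (X ^ m * (X - C a) ^ n)).eval c =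
      c ^ (m - 1) * (c - a) ^ (n - 1) * ((m + n : ℕ) * c - m * a) := by
  obtain ⟨m, rfl⟩ := Nat.exists_eq_succ_of_ne_zero hm
  obtain ⟨n, rfl⟩ := Nat.exists_eq_succ_of_ne_zero hn
  simp [derivative_pow]
  ring

/-- For suitable `α` the critical points of `z ^ (d - p) * (z - α) ^ p` are `0`, `α`, and a
preimage of `α`. -/
theorem exists_mem_mandelbrotSet_norm_pow_eq {d : ℕ} (hpd : p < d) (hd : ¬ p ∣ d) :
    ∃ f ∈ mandelbrotSet d p, ∃ α ∈ critPoints f, α ≠ 0 ∧ ‖α‖ ^ (d - 1) = (p : ℝ) ^ p := by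
  have hp : p.Prime := Fact.out
  have hp2 := hp.two_le
  obtain ⟨m, hm⟩ : ∃ m, d = m + p := ⟨d - p, by omega⟩
  have hm0 : m ≠ 0 := by omega
  have hpm : ¬ p ∣ m := fun h => hd (hm ▸ dvd_add h dvd_rfl)
  have hdK : (d : ℂ_[p]) ≠ 0 := Nat.cast_ne_zero.2 (by omega)
  have hmK : (m : ℂ_[p]) ≠ 0 := Nat.cast_ne_zero.2 hm0
  have hpK : (p : ℂ_[p]) ≠ 0 := Nat.cast_ne_zero.2 (by omega)
  have hp0 : (p : ℝ) ≠ 0 := by exact_mod_cast hp.ne_zero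
  -- The remaining critical point is `m / d * α`, with value `κ * α ^ d`; the choice `α ^ (d - 1) =
  -- κ⁻¹` sends it to `α`, hence next to the fixed point 0.
  set κ : ℂ_[p] := (m / d) ^ m * (-(p / d)) ^ p with hκ
  have hκ0 : κ ≠ 0 := mul_ne_zero (pow_ne_zero _ (div_ne_zero hmK hdK))
    (pow_ne_zero _ (neg_ne_zero.2 (div_ne_zero hpK hdK)))
  have hκn : ‖κ‖ = ((p : ℝ) ^ p)⁻¹ := by
    rw [hκ, norm_mul, norm_pow, norm_pow, norm_neg, norm_div, norm_div, norm_natCast_eq_one hd,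
      norm_natCast_eq_one hpm, norm_natCast_prime]
    simp
  obtain ⟨α, hα⟩ := IsAlgClosed.exists_pow_nat_eq κ⁻¹ (by omega : 0 < d - 1)
  have hα0 : α ≠ 0 := by
    rintro rfl
    rw [zero_pow (by omega), eq_comm, inv_eq_zero] at hα
    exact hκ0 hα
  have heval : ∀ z : ℂ_[p], (X ^ m * (X - C α) ^ p : ℂ_[p][X]).eval z = z ^ m * (z - α) ^ p := by
    simp
  have h0 : (X ^ m * (X - C α) ^ p : ℂ_[p][X]).eval 0 = 0 := by
    rw [heval, zero_pow hm0, zero_mul]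
  have hα1 : (X ^ m * (X - C α) ^ p : ℂ_[p][X]).eval α = 0 := by
    rw [heval, sub_self, zero_pow hp.ne_zero, mul_zero]
  refine ⟨X ^ m * (X - C α) ^ p, ⟨⟨?_, ?_, h0⟩, fun c hc => ?_⟩, α, ?_, hα0, ?_⟩
  · exact (monic_X_pow m).mul ((monic_X_sub_C α).pow p)
  · rw [(monic_X_pow m).natDegree_mul ((monic_X_sub_C α).pow p), natDegree_X_pow,
      (monic_X_sub_C α).natDegree_pow, natDegree_X_sub_C, mul_one, hm]
  · rw [critPoints, Set.mem_ofPred_eq, eval_derivative_X_pow_mul_X_sub_C_pow hm0 hp.ne_zero,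
      ← hm] at hc
    apply isBounded_orbit_of_eval_eval_eq_zero h0
    rcases mul_eq_zero.1 hc with hc | hc
    · rcases mul_eq_zero.1 hc with hc | hc
      · rw [eq_zero_of_pow_eq_zero hc, h0, h0]
      · rw [sub_eq_zero.1 (eq_zero_of_pow_eq_zero hc), hα1, h0]
    · have hc1 : c = m / d * α := by
        field_simp
        linear_combination hc
      have hc2 : c - α = -(p / d) * α := by
        have hd' : (d : ℂ_[p]) = m + p := by rw [hm, Nat.cast_add]
        rw [hc1]
        field_simp
        rw [hd']
        ring
      have hfix : (X ^ m * (X - C α) ^ p : ℂ_[p][X]).eval c = α := by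
        rw [heval, hc2, hc1, mul_pow, mul_pow]
        calc _ = κ * (α ^ (d - 1) * α) := by
              rw [← pow_succ, Nat.sub_add_cancel (by omega), hκ, hm, pow_add]
              ring
          _ = α := by rw [hα, ← mul_assoc, mul_inv_cancel₀ hκ0, one_mul]
      rw [hfix, hα1]
  · rw [critPoints, Set.mem_ofPred_eq, eval_derivative_X_pow_mul_X_sub_C_pow hm0 hp.ne_zero,
      sub_self, zero_pow (by omega)]
    simp
  · rw [← norm_pow, hα, norm_inv, hκn, inv_inv]

end Dynamics

end PadicMandelbrot

theorem theorem1p1 (d p : ℕ) [Fact p.Prime] :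
    (d < 2 * p → p < d →
      PadicMandelbrot.critRadius d p = (((p : ℝ) / ((d : ℝ) - 1) : ℝ) : EReal)) ∧
    (d = 2 * p → PadicMandelbrot.critRadius d p = 0) := by
  have hp : p.Prime := Fact.out
  have hp2 := hp.two_le
  have hp1 : (1 : ℝ) < p := by exact_mod_cast hp.one_lt
  constructor
  · intro hdp hpd
    have hpnd : ¬ p ∣ d := by
      rintro ⟨k, rfl⟩
      have h1 : k < 2 := lt_of_mul_lt_mul_left (by omega : p * k < p * 2) (Nat.zero_le _)
      have h2 : p * k ≤ p * 1 := Nat.mul_le_mul_left p (by omega)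
      omega
    have hd1 : (0 : ℝ) < (d : ℝ) - 1 := by
      have : (1 : ℝ) < d := by exact_mod_cast (by omega : 1 < d)
      linarith
    have hcast : ((d - 1 : ℕ) : ℝ) = (d : ℝ) - 1 := by
      rw [Nat.cast_sub (by omega), Nat.cast_one]
    refine le_antisymm (PadicMandelbrot.critRadius_le fun f hf c hc hc0 => ?_) ?_
    · have hc1 : 0 < ‖c‖ := norm_pos_iff.2 hc0
      rcases PadicMandelbrot.norm_critPoint_le hpd hdp.le hf hc with h | ⟨-, h⟩
      · exact (Real.logb_nonpos hp1 hc1.le h).trans (by positivity)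
      · have := Real.logb_le_logb_of_le hp1 (by positivity) h
        rw [Real.logb_pow, Real.logb_pow, Real.logb_self_eq_one hp1, mul_one, hcast] at this
        rwa [le_div_iff₀ hd1, mul_comm]
    · obtain ⟨f, hf, α, hα, hα0, hnorm⟩ :=
        PadicMandelbrot.exists_mem_mandelbrotSet_norm_pow_eq hpd hpnd
      refine le_trans (le_of_eq ?_) (PadicMandelbrot.le_critRadius hf hα hα0)
      have := congrArg (Real.logb p) hnorm
      rw [Real.logb_pow, Real.logb_pow, Real.logb_self_eq_one hp1, mul_one, hcast] at this
      rw [eq_div_of_mul_eq hd1.ne' ((mul_comm _ _).trans this)]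
  · intro hd
    refine le_antisymm (PadicMandelbrot.critRadius_le fun f hf c hc hc0 => ?_) ?_
    · rcases PadicMandelbrot.norm_critPoint_le (by omega) hd.le hf hc with h | ⟨h, -⟩
      · exact Real.logb_nonpos hp1 (norm_nonneg c) h
      · exact absurd ⟨2, by rw [hd, mul_comm]⟩ h
    -- The critical point `-1` has norm 1, which gives the lower bound 0.
    · have hmem := PadicMandelbrot.X_add_one_pow_sub_one_mem_mandelbrotSet (p := p)
        (by omega : 2 ≤ d)
      have hcrit : (-1 : ℂ_[p]) ∈
          PadicMandelbrot.critPoints ((Polynomial.X + Polynomial.C 1) ^ d - Polynomial.C 1) := by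
        simp [PadicMandelbrot.critPoints, Polynomial.derivative_pow, show d - 1 ≠ 0 by omega]
      have := PadicMandelbrot.le_critRadius hmem hcrit (by simp)
      simpa using this
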